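/- Let $n\ge 2$ be an integer and let $P=\mathbb N^\times\ltimes\mathbb Z/n\mathbb Z$ be the left cancellative monoid with product $(a,[k])(b,[l])=(ab,[kb+l])$. Let $\mathcal I_l$ be its left inverse hull, i.e. the inverse semigroup of partial bijections of $P$ generated by the left multiplication maps $c\colon x\mapsto cx$ ($c\in P$), and let $E$ be its semilattice of idempotents, identified with subsets of $P$ (via their domains). Let $\Omega$ be the space, with the topology of pointwise convergence, of all semicharacters $\chi$ of $E$ (nonzero multiplicative maps $E\to\{0,1\}$) such that $\chi(f)=\bigvee_{i=1}^m\chi(e_i)$ whenever $f,e_1,\dots,e_m\in E$ and $f=\bigcup_{i=1}^m e_i$ as sets. For $c\in P$ let $\chi_c\in\Omega$ be the principal character, $\chi_c(e)=1$ if $cP\subseteq e$ and $\chi_c(e)=0$ otherwise. Let $\overline E$ be the family of finite unions of sets $e\setminus(f_1\cup\dots\cup f_r)$ with $e,f_j\in E$, $f_j\subseteq e$; every $\chi\in\Omega$ extends canonically to $\overline E$. Let $\overline{\mathcal I}_l$ be the inverse semigroup of all restrictions $s|_X$ with $s\in\mathcal I_l$, $X\in\overline E$, $X\subseteq\operatorname{dom}s$.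 Let $\mathcal G=\overline{\mathcal I}_l\ltimes\Omega$ be the groupoid of germs $[s,\chi]$ with $s\in\overline{\mathcal I}_l$, $\chi\in\Omega$, $\chi(s^{-1}s)=1$, where $[s,\chi]=[t,\psi]$ iff $\chi=\psi$ and $se=te$ for some $e\in\overline E$ with $\chi(e)=1$; the source of $[s,\chi]$ is $\chi$, its target is $s\cdot\chi$, where $(s\cdot\chi)(e)=\chi(s^{-1}es)$, and the topology has as basis the sets $[s,U]=\{[s,\chi]:\chi\in U\}$ with $U\subseteq\{\chi\in\Omega:\chi(s^{-1}s)=1\}$ open. Let $\operatorname{Iso}(\mathcal G)^\circ$ be the interior of the set of germs whose source and target coincide, and let $P^*\ltimes\Omega=\{[u,\chi]:u\in P^*,\ \chi\in\Omega\}$, where $P^*$ is the group of invertible elements of $P$. Then $$P^*\ltimes\Omega\ \subsetneq\ \operatorname{Iso}(\mathcal G)^\circ .$$ More precisely, with $s=(n,[0])\,(1,[1])\,(n,[0])^{-1}\in\mathcal I_l$, the germ $[s,\chi_{(n,[0])}]$ belongs to $\operatorname{Iso}(\mathcal G)^\circ$ but not to $P^*\ltimes\Omega$. Consequently $C^*_r(P^*\ltimes\Omega)\subsetneq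 C^*_r(\operatorname{Iso}(\mathcal G)^\circ)$ as subalgebras of $C^*_r(\mathcal G)$, where for an open subgroupoid $H$ of $\mathcal G$ the algebra $C^*_r(H)$ is the norm closure of the image of $C_c(H)$ (functions extended by zero) under the direct sum of the left regular representations of $\mathcal G$ on $\bigoplus_{\chi\in\Omega}\ell^2(\mathcal G_\chi)$, with $\mathcal G_\chi$ the set of germs with source $\chi$. -/

import Mathlib

namespace Hull

/-! ### Partial bijections of a set

`P ≃. P` is the symmetric inverse monoid of `P`. Composition `s ∘ t` is `t.trans s`, the inverse
is `s.symm`, and the idempotents are the identity maps of subsets. -/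

section PartialBijections

variable {P : Type*}

/-- The idempotent partial bijection with domain `X`. -/
noncomputable def idem (X : Set P) : P ≃. P :=
  open Classical in PEquiv.ofSet X

/-- The domain of a partial bijection. -/
def dom (s : P ≃. P) : Set P := {x | ∃ y, y ∈ s x}

/-- The set `s⁻¹(X)`: under the identification of idempotents with subsets, this is the
idempotent `s⁻¹ X s`. -/
def pre (s : P ≃. P) (X : Set P) : Set P := {x | ∃ y ∈ s x, y ∈ X}

/-- The restriction `s e` of `s` to `X`, where `e` is the idempotent with domain `X`. -/
noncomputable def restrict (s : P ≃. P) (X : Set P) : P ≃. P := (idem X).trans s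

theorem mem_idem {X : Set P} {x y : P} : y ∈ idem X x ↔ y = x ∧ y ∈ X := by
  classical
  unfold idem
  exact PEquiv.mem_ofSet_iff

theorem mem_restrict {s : P ≃. P} {X : Set P} {x y : P} :
    y ∈ restrict s X x ↔ x ∈ X ∧ y ∈ s x := by
  unfold restrict
  rw [PEquiv.mem_trans]
  constructor
  · rintro ⟨b, hb, hy⟩
    obtain ⟨rfl, hX⟩ := mem_idem.1 hb
    exact ⟨hX, hy⟩
  · rintro ⟨hx, hy⟩
    exact ⟨x, mem_idem.2 ⟨rfl, hx⟩, hy⟩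

theorem pequiv_ext {s t : P ≃. P} (h : ∀ x y, y ∈ s x ↔ y ∈ t x) : s = t :=
  PEquiv.ext fun x => Option.ext fun y => h x y

theorem pequiv_fun {s : P ≃. P} {x y z : P} (hy : y ∈ s x) (hz : z ∈ s x) : y = z :=
  Option.mem_unique hy hz

theorem restrict_eq_iff {s t : P ≃. P} {X : Set P} :
    restrict s X = restrict t X ↔ ∀ x ∈ X, ∀ y, y ∈ s x ↔ y ∈ t x := by
  constructor
  · intro h x hx y
    have : y ∈ restrict s X x ↔ y ∈ restrict t X x := by rw [h]
    rw [mem_restrict, mem_restrict] at this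
    simpa only [hx, true_and] using this
  · intro h
    refine pequiv_ext fun x y => ?_
    rw [mem_restrict, mem_restrict]
    exact and_congr_right fun hx => h x hx y

theorem pre_trans (s t : P ≃. P) (X : Set P) : pre (t.trans s) X = pre t (pre s X) := by
  ext x
  simp only [pre, Set.mem_ofPred_eq, PEquiv.mem_trans]
  constructor
  · rintro ⟨y, ⟨b, hb, hy⟩, hX⟩
    exact ⟨b, hb, y, hy, hX⟩
  · rintro ⟨b, hb, y, hy, hX⟩
    exact ⟨y, ⟨b, hb, hy⟩, hX⟩

theorem dom_eq_pre (s : P ≃. P) : dom s = pre s Set.univ := by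
  ext x; simp [dom, pre]

theorem dom_trans (s t : P ≃. P) : dom (t.trans s) = pre t (dom s) := by
  rw [dom_eq_pre, pre_trans, ← dom_eq_pre]

theorem pre_symm_dom (s : P ≃. P) : pre s (dom s.symm) = dom s := by
  ext x
  constructor
  · rintro ⟨y, hy, -⟩
    exact ⟨y, hy⟩
  · rintro ⟨y, hy⟩
    exact ⟨y, hy, x, (PEquiv.mem_iff_mem s).2 hy⟩

theorem pre_inter (s : P ≃. P) (X Y : Set P) : pre s (X ∩ Y) = pre s X ∩ pre s Y := by
  ext x
  constructor
  · rintro ⟨y, hy, hX, hY⟩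
    exact ⟨⟨y, hy, hX⟩, ⟨y, hy, hY⟩⟩
  · rintro ⟨⟨y, hy, hX⟩, ⟨z, hz, hY⟩⟩
    obtain rfl := pequiv_fun hy hz
    exact ⟨y, hy, hX, hY⟩

theorem pre_diff (s : P ≃. P) (X Y : Set P) : pre s (X \ Y) = pre s X \ pre s Y := by
  ext x
  constructor
  · rintro ⟨y, hy, hX, hY⟩
    refine ⟨⟨y, hy, hX⟩, ?_⟩
    rintro ⟨z, hz, hZ⟩
    obtain rfl := pequiv_fun hy hz
    exact hY hZ
  · rintro ⟨⟨y, hy, hX⟩, h⟩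
    exact ⟨y, hy, hX, fun hY => h ⟨y, hy, hY⟩⟩

theorem pre_mono (s : P ≃. P) {X Y : Set P} (h : X ⊆ Y) : pre s X ⊆ pre s Y :=
  fun _ ⟨y, hy, hX⟩ => ⟨y, hy, h hX⟩

theorem pre_iUnion {ι : Sort*} (s : P ≃. P) (X : ι → Set P) :
    pre s (⋃ i, X i) = ⋃ i, pre s (X i) := by
  ext x
  simp only [pre, Set.mem_iUnion, Set.mem_ofPred_eq]
  constructor
  · rintro ⟨y, hy, i, hi⟩
    exact ⟨i, y, hy, hi⟩
  · rintro ⟨i, y, hy, hi⟩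
    exact ⟨y, hy, i, hi⟩

theorem pre_idem (X Y : Set P) : pre (idem X) Y = X ∩ Y := by
  ext x
  simp only [pre, mem_idem, Set.mem_ofPred_eq]
  constructor
  · rintro ⟨y, ⟨rfl, h⟩, hY⟩
    exact ⟨h, hY⟩
  · rintro ⟨h, hY⟩
    exact ⟨x, ⟨rfl, h⟩, hY⟩

theorem pre_restrict (s : P ≃. P) (X Y : Set P) : pre (restrict s X) Y = X ∩ pre s Y := by
  rw [restrict, pre_trans, pre_idem]

end PartialBijections

/-! ### The left inverse hull of a left cancellative monoid -/

section LeftHull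

variable {P : Type*} [LeftCancelMonoid P]

/-- Left multiplication `P → cP`, `x ↦ c x`, as a partial bijection of `P`. -/
noncomputable def leftMul (c : P) : P ≃. P where
  toFun x := some (c * x)
  invFun y := open Classical in if h : ∃ x, c * x = y then some h.choose else none
  inv x y := by
    constructor
    · intro h
      split_ifs at h with hy
      have h1 := hy.choose_spec
      have h2 := Option.some.inj h
      rw [h2] at h1
      rw [h1]
    · intro h
      have hy : ∃ x, c * x = y := ⟨x, Option.some.inj h⟩
      rw [dif_pos hy]
      exact congrArg some (mul_left_cancel (hy.choose_spec.trans (Option.some.inj h).symm))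

theorem mem_leftMul {c x y : P} : y ∈ leftMul c x ↔ y = c * x := by
  change some (c * x) = some y ↔ _
  rw [Option.some.injEq, eq_comm]

/-- Membership in the left inverse hull `I_l(P)`, the inverse semigroup of partial bijections of
`P` generated by the left multiplication maps. -/
inductive InHull : (P ≃. P) → Prop
  | leftMul (c : P) : InHull (leftMul c)
  | trans {s t : P ≃. P} : InHull t → InHull s → InHull (t.trans s)
  | symm {s : P ≃. P} : InHull s → InHull s.symm

variable (P) in
/-- The semilattice `E` of idempotents of `I_l(P)`, identified with a family of subsets of `P`;
the product of idempotents is the intersection of sets. -/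
abbrev E : Type _ := {X : Set P // InHull (idem X)}

theorem inHull_idem_univ : InHull (idem (Set.univ : Set P)) := by
  have h : idem (Set.univ : Set P) = leftMul 1 :=
    pequiv_ext fun x y => by rw [mem_idem, mem_leftMul]; simp
  rw [h]
  exact .leftMul 1

theorem inHull_idem_inter {X Y : Set P} (hX : InHull (idem X)) (hY : InHull (idem Y)) :
    InHull (idem (X ∩ Y)) := by
  have h : idem (X ∩ Y) = (idem X).trans (idem Y) := by
    refine pequiv_ext fun x y => ?_
    rw [PEquiv.mem_trans]
    simp only [mem_idem]
    constructor
    · rintro ⟨rfl, h1, h2⟩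
      exact ⟨y, ⟨rfl, h1⟩, rfl, h2⟩
    · rintro ⟨b, ⟨rfl, h1⟩, rfl, h2⟩
      exact ⟨rfl, h1, h2⟩
  rw [h]
  exact hX.trans hY

theorem inHull_idem_pre {s : P ≃. P} {X : Set P} (hs : InHull s) (hX : InHull (idem X)) :
    InHull (idem (pre s X)) := by
  have h : idem (pre s X) = (s.trans (idem X)).trans s.symm := by
    refine pequiv_ext fun x y => ?_
    rw [PEquiv.mem_trans]
    simp only [PEquiv.mem_trans, mem_idem]
    constructor
    · rintro ⟨rfl, z, hz, hzX⟩
      exact ⟨z, ⟨z, hz, rfl, hzX⟩, (PEquiv.mem_iff_mem s).2 hz⟩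
    · rintro ⟨z, ⟨z', hz, rfl, hzX⟩, hy⟩
      have hy' := (PEquiv.mem_iff_mem s).1 hy
      exact ⟨PEquiv.inj s hy' hz, z, hy', hzX⟩
  rw [h]
  exact (hs.trans hX).trans hs.symm

namespace E

/-- The product of two idempotents. -/
def inter (e f : E P) : E P := ⟨e.1 ∩ f.1, inHull_idem_inter e.2 f.2⟩

variable (P) in
/-- The identity of `P` as an idempotent. -/
def top : E P := ⟨Set.univ, inHull_idem_univ⟩

/-- The idempotent `s⁻¹ e s`. -/
def comap {s : P ≃. P} (hs : InHull s) (e : E P) : E P := ⟨pre s e.1, inHull_idem_pre hs e.2⟩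

end E

/-- Elements of the hull commute with right multiplication: `s (p q) = s (p) q`. -/
theorem InHull.mul_right {s : P ≃. P} (hs : InHull s) :
    ∀ {x y : P} (q : P), y ∈ s x → y * q ∈ s (x * q) := by
  induction hs with
  | leftMul c =>
    intro x y q h
    rw [mem_leftMul] at h ⊢
    rw [h, mul_assoc]
  | trans _ _ iht ihs =>
    intro x y q h
    rw [PEquiv.mem_trans] at h ⊢
    obtain ⟨b, hb, hy⟩ := h
    exact ⟨b * q, iht q hb, ihs q hy⟩
  | symm _ ih =>
    intro x y q h
    rw [PEquiv.mem_iff_mem] at h ⊢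
    exact ih q h

theorem E.mul_mem (e : E P) {x : P} (hx : x ∈ e.1) (q : P) : x * q ∈ e.1 :=
  (mem_idem.1 (e.2.mul_right q (mem_idem.2 ⟨rfl, hx⟩))).2

/-- Membership in the boolean closure `Ē` of `E`: the sets of the form
`⋃ i, (e i \ ⋃ j, f i j)` (finite unions) with `f i j ≤ e i` in `E`. -/
def IsBool (X : Set P) : Prop :=
  ∃ (m : ℕ) (e : Fin m → E P) (F : Fin m → Finset (E P)),
    (∀ i, ∀ f ∈ F i, f.1 ⊆ (e i).1) ∧ X = ⋃ i, ((e i).1 \ ⋃ f ∈ F i, f.1)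

theorem IsBool.of_finite {ι : Type*} [Finite ι] (e : ι → E P) (F : ι → Finset (E P)) :
    IsBool (⋃ i, ((e i).1 \ ⋃ f ∈ F i, f.1)) := by
  classical
  obtain ⟨m, ⟨φ⟩⟩ := Finite.exists_equiv_fin ι
  refine ⟨m, fun i => e (φ.symm i),
    fun i => (F (φ.symm i)).image (fun f => E.inter (e (φ.symm i)) f), ?_, ?_⟩
  · intro i f hf
    obtain ⟨g, -, rfl⟩ := Finset.mem_image.1 hf
    exact Set.inter_subset_left
  · rw [← φ.symm.surjective.iUnion_comp]
    refine Set.iUnion_congr fun i => ?_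
    ext x
    simp only [Set.mem_sdiff, Set.mem_iUnion, Finset.mem_image, exists_prop, not_exists, not_and]
    refine and_congr_right fun hx => ⟨?_, ?_⟩
    · rintro h _ ⟨g, hg, rfl⟩ hxg
      exact h g hg hxg.2
    · intro h f hf hxf
      exact h _ ⟨f, hf, rfl⟩ ⟨hx, hxf⟩

theorem E.isBool (e : E P) : IsBool e.1 := by
  have := IsBool.of_finite (fun _ : Unit => e) (fun _ => ∅)
  simpa [Set.iUnion_const] using this

theorem IsBool.inter {X Y : Set P} (hX : IsBool X) (hY : IsBool Y) : IsBool (X ∩ Y) := by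
  classical
  obtain ⟨m, e, F, -, rfl⟩ := hX
  obtain ⟨k, e', F', -, rfl⟩ := hY
  have := IsBool.of_finite (fun p : Fin m × Fin k => E.inter (e p.1) (e' p.2))
    (fun p => F p.1 ∪ F' p.2)
  convert this using 1
  ext x
  simp only [Set.mem_inter_iff, Set.mem_iUnion, Set.mem_sdiff, Finset.mem_union, E.inter,
    exists_prop, not_exists, not_and, Prod.exists]
  constructor
  · rintro ⟨⟨i, h1, h2⟩, ⟨j, h3, h4⟩⟩
    exact ⟨i, j, ⟨h1, h3⟩, fun f hf => hf.elim (h2 f) (h4 f)⟩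
  · rintro ⟨i, j, ⟨h1, h3⟩, h⟩
    exact ⟨⟨i, h1, fun f hf => h f (Or.inl hf)⟩, ⟨j, h3, fun f hf => h f (Or.inr hf)⟩⟩

theorem IsBool.pre_hull {s : P ≃. P} (hs : InHull s) {X : Set P} (hX : IsBool X) :
    IsBool (pre s X) := by
  classical
  obtain ⟨m, e, F, -, rfl⟩ := hX
  have := IsBool.of_finite (fun i => E.comap hs (e i)) (fun i => (F i).image (E.comap hs))
  convert this using 1
  rw [pre_iUnion]
  refine Set.iUnion_congr fun i => ?_
  rw [pre_diff]
  congr 1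
  rw [Finset.set_biUnion_finset_image, pre_iUnion]
  refine Set.iUnion_congr fun f => ?_
  rw [pre_iUnion]
  rfl

/-- Membership in the enlarged hull `Ī_l = {s e | s ∈ I_l, e ∈ Ē, e ≤ s⁻¹ s}`. -/
def InBoolHull (t : P ≃. P) : Prop :=
  ∃ s X, InHull s ∧ IsBool X ∧ X ⊆ dom s ∧ t = restrict s X

theorem InBoolHull.pre {t : P ≃. P} (ht : InBoolHull t) {X : Set P} (hX : IsBool X) :
    IsBool (pre t X) := by
  obtain ⟨s, Y, hs, hY, -, rfl⟩ := ht
  rw [pre_restrict]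
  exact hY.inter (hX.pre_hull hs)

theorem InBoolHull.dom {t : P ≃. P} (ht : InBoolHull t) : IsBool (dom t) := by
  rw [dom_eq_pre]
  exact ht.pre (E.top P).isBool

theorem InHull.inBoolHull {s : P ≃. P} (hs : InHull s) : InBoolHull s := by
  refine ⟨s, Hull.dom s, hs, ?_, subset_rfl, ?_⟩
  · rw [dom_eq_pre]
    exact (E.top P).isBool.pre_hull hs
  · refine pequiv_ext fun x y => ?_
    rw [mem_restrict]
    exact ⟨fun h => ⟨⟨y, h⟩, h⟩, fun h => h.2⟩

theorem InBoolHull.symm {t : P ≃. P} (ht : InBoolHull t) : InBoolHull t.symm := by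
  obtain ⟨s, X, hs, hX, hXs, rfl⟩ := ht
  refine ⟨s.symm, Hull.pre s.symm X, hs.symm, hX.pre_hull hs.symm, ?_, ?_⟩
  · rw [dom_eq_pre]
    exact pre_mono _ (Set.subset_univ _)
  · refine pequiv_ext fun y x => ?_
    rw [PEquiv.mem_iff_mem, mem_restrict, mem_restrict]
    constructor
    · rintro ⟨hx, hy⟩
      have hy' := (PEquiv.mem_iff_mem s).2 hy
      exact ⟨⟨x, hy', hx⟩, hy'⟩
    · rintro ⟨⟨z, hz, hzX⟩, hx⟩
      obtain rfl := pequiv_fun hz hx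
      exact ⟨hzX, (PEquiv.mem_iff_mem s).1 hx⟩

theorem InBoolHull.trans {s t : P ≃. P} (ht : InBoolHull t) (hs : InBoolHull s) :
    InBoolHull (t.trans s) := by
  have hd : IsBool (Hull.dom (t.trans s)) := by
    rw [dom_trans]
    exact ht.pre hs.dom
  obtain ⟨s', X, hs', hX, hXs, rfl⟩ := hs
  obtain ⟨t', Y, ht', hY, hYt, rfl⟩ := ht
  refine ⟨t'.trans s', _, ht'.trans hs', hd, ?_, ?_⟩
  · rintro x ⟨y, hy⟩
    rw [PEquiv.mem_trans] at hy
    obtain ⟨b, hb, hy⟩ := hy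
    exact ⟨y, (PEquiv.mem_trans _ _ _ _).2 ⟨b, (mem_restrict.1 hb).2, (mem_restrict.1 hy).2⟩⟩
  · refine pequiv_ext fun x y => ?_
    rw [mem_restrict]
    constructor
    · intro h
      refine ⟨⟨y, h⟩, ?_⟩
      rw [PEquiv.mem_trans] at h ⊢
      obtain ⟨b, hb, hy⟩ := h
      exact ⟨b, (mem_restrict.1 hb).2, (mem_restrict.1 hy).2⟩
    · rintro ⟨⟨z, hz⟩, h⟩
      have hz' := hz
      rw [PEquiv.mem_trans] at h hz
      obtain ⟨b, hb, hy⟩ := h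
      obtain ⟨b', hb', hy'⟩ := hz
      obtain rfl := pequiv_fun hb (mem_restrict.1 hb').2
      obtain rfl := pequiv_fun hy (mem_restrict.1 hy').2
      exact hz'

variable (P) in
/-- The inverse semigroup `Ī_l(P)`. -/
abbrev BoolHull : Type _ := {t : P ≃. P // InBoolHull t}

namespace BoolHull

/-- The product `s t` in `Ī_l(P)` (apply `t` first). -/
def mul (s t : BoolHull P) : BoolHull P := ⟨t.1.trans s.1, t.2.trans s.2⟩

/-- The inverse in `Ī_l(P)`. -/
def inv (s : BoolHull P) : BoolHull P := ⟨s.1.symm, s.2.symm⟩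

variable (P) in
/-- The identity map of `P` as an element of `Ī_l(P)`. -/
noncomputable def one : BoolHull P := ⟨idem Set.univ, inHull_idem_univ.inBoolHull⟩

/-- Inclusion of `I_l(P)` in `Ī_l(P)`. -/
def ofHull {s : P ≃. P} (hs : InHull s) : BoolHull P := ⟨s, hs.inBoolHull⟩

end BoolHull

/-! ### The space `Ω` -/

/-- `χ` is a semicharacter of `E` (a nonzero multiplicative map to `{0, 1}`) that preserves the
finite unions that exist in `E`, i.e. `χ f = ⋁ χ (e i)` whenever `f = ⋃ e i`. -/
structure IsSpectral (χ : E P → Bool) : Prop where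
  nonzero : ∃ e, χ e = true
  mul : ∀ e f, χ (E.inter e f) = (χ e && χ f)
  union : ∀ (f : E P) (S : Finset (E P)), f.1 = ⋃ e ∈ S, e.1 →
    (χ f = true ↔ ∃ e ∈ S, χ e = true)

variable (P) in
/-- The space `Ω`. -/
@[ext] structure Omega where
  /-- The underlying semicharacter of `E`. -/
  toFun : E P → Bool
  spectral : IsSpectral toFun

/-- The topology of pointwise convergence on `E`, where `{0, 1}` is discrete. -/
instance : TopologicalSpace (Omega P) := TopologicalSpace.induced Omega.toFun inferInstance

namespace Omega

/-- `χ.Mem X` says that the extension of `χ` to `Ē` takes the value `1` at `X ∈ Ē`. The value of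
the extension at `⋃ i, (e i \ ⋃ j, f i j)` is `1` exactly if `χ (e i) = 1` and `χ (f i j) = 0`
for all `j`, for some `i`; that is, if `X` has such a representation in which this occurs, or,
equivalently, if `X` contains a set `e \ ⋃ j, f j` with `χ e = 1` and all `χ (f j) = 0`. -/
def Mem (χ : Omega P) (X : Set P) : Prop :=
  ∃ (e : E P) (F : Finset (E P)), χ.1 e = true ∧ (∀ f ∈ F, χ.1 f = false) ∧
    e.1 \ ⋃ f ∈ F, f.1 ⊆ X

variable (χ : Omega P)

variable {χ} in
theorem Mem.mono {X Y : Set P} (h : χ.Mem X) (hXY : X ⊆ Y) : χ.Mem Y := by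
  obtain ⟨e, F, h1, h2, h3⟩ := h
  exact ⟨e, F, h1, h2, h3.trans hXY⟩

variable {χ} in
theorem Mem.inter {X Y : Set P} (hX : χ.Mem X) (hY : χ.Mem Y) : χ.Mem (X ∩ Y) := by
  classical
  obtain ⟨e, F, h1, h2, h3⟩ := hX
  obtain ⟨e', F', h1', h2', h3'⟩ := hY
  refine ⟨E.inter e e', F ∪ F', by rw [χ.2.mul, h1, h1']; rfl, ?_, ?_⟩
  · intro f hf
    exact (Finset.mem_union.1 hf).elim (h2 f) (h2' f)
  · rintro x ⟨hx, hxF⟩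
    simp only [Set.mem_iUnion, exists_prop, not_exists, not_and, Finset.mem_union] at hxF
    refine ⟨h3 ⟨hx.1, ?_⟩, h3' ⟨hx.2, ?_⟩⟩
    · simpa using fun f hf => hxF f (Or.inl hf)
    · simpa using fun f hf => hxF f (Or.inr hf)

theorem not_mem_empty : ¬ χ.Mem ∅ := by
  classical
  rintro ⟨e, F, h1, h2, h3⟩
  have h := (χ.2.union e (F.image (E.inter e)) ?_).1 h1
  · obtain ⟨g, hg, hgt⟩ := h
    obtain ⟨f, hf, rfl⟩ := Finset.mem_image.1 hg
    rw [χ.2.mul, h2 f hf] at hgt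
    simp at hgt
  · ext x
    simp only [Set.mem_iUnion, Finset.mem_image, exists_prop]
    constructor
    · intro hx
      by_contra hcon
      refine h3 ⟨hx, ?_⟩
      simp only [Set.mem_iUnion, exists_prop, not_exists, not_and]
      exact fun f hf hxf => hcon ⟨_, ⟨f, hf, rfl⟩, hx, hxf⟩
    · rintro ⟨_, ⟨f, -, rfl⟩, hx⟩
      exact hx.1

variable {χ} in
theorem Mem.not_disjoint {X Y : Set P} (hX : χ.Mem X) (hY : χ.Mem Y) : ¬ Disjoint X Y :=
  fun h => χ.not_mem_empty (by simpa [h.inter_eq] using hX.inter hY)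

theorem mem_of_true {e : E P} (h : χ.1 e = true) : χ.Mem e.1 :=
  ⟨e, ∅, h, by simp, by simp⟩

theorem mem_univ : χ.Mem Set.univ := by
  obtain ⟨e, he⟩ := χ.2.nonzero
  exact (χ.mem_of_true he).mono (Set.subset_univ _)

theorem mem_compl_of_false {e : E P} (h : χ.1 e = false) : χ.Mem e.1ᶜ := by
  obtain ⟨g, hg⟩ := χ.2.nonzero
  exact ⟨g, {e}, hg, by simpa using h, fun x hx => by simpa using hx.2⟩

theorem mem_iff (e : E P) : χ.Mem e.1 ↔ χ.1 e = true := by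
  refine ⟨fun h => ?_, χ.mem_of_true⟩
  by_contra hc
  exact h.not_disjoint (χ.mem_compl_of_false (by simpa using hc)) disjoint_compl_right

theorem mem_biInter {ι : Type*} (S : Finset ι) (X : ι → Set P) (h : ∀ i ∈ S, χ.Mem (X i)) :
    χ.Mem (⋂ i ∈ S, X i) := by
  classical
  induction S using Finset.induction_on with
  | empty => simpa using χ.mem_univ
  | insert a S ha ih =>
    rw [Finset.set_biInter_insert]
    exact (h a (Finset.mem_insert_self a S)).inter
      (ih fun i hi => h i (Finset.mem_insert_of_mem hi))

/-- On the boolean closure, the extension of `χ` is two-valued. -/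
theorem mem_or_compl {X : Set P} (hX : IsBool X) : χ.Mem X ∨ χ.Mem Xᶜ := by
  obtain ⟨m, e, F, -, rfl⟩ := hX
  by_cases h : ∃ i, χ.1 (e i) = true ∧ ∀ f ∈ F i, χ.1 f = false
  · obtain ⟨i, h1, h2⟩ := h
    exact Or.inl ⟨e i, F i, h1, h2, Set.subset_iUnion_of_subset i subset_rfl⟩
  · right
    push Not at h
    rw [Set.compl_iUnion]
    have := χ.mem_biInter Finset.univ (fun i => ((e i).1 \ ⋃ f ∈ F i, f.1)ᶜ) ?_
    · simpa using this
    intro i _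
    by_cases hi : χ.1 (e i) = true
    · obtain ⟨f, hf, hft⟩ := h i hi
      refine (χ.mem_of_true (e := f) (by simpa using hft)).mono ?_
      intro x hx hx'
      exact hx'.2 (Set.mem_biUnion (t := fun g : E P => g.1) hf hx)
    · exact (χ.mem_compl_of_false (by simpa using hi)).mono
        (Set.compl_subset_compl.2 Set.sdiff_subset)

/-- The action `(s · χ)(e) = χ(s⁻¹ e s)` of `Ī_l` on `Ω`, for `χ(s⁻¹ s) = 1`. -/
noncomputable def act (s : BoolHull P) (χ : Omega P) (h : χ.Mem (dom s.1)) : Omega P :=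
  ⟨fun e => open Classical in decide (χ.Mem (pre s.1 e.1)), by
    classical
    refine ⟨⟨E.top P, ?_⟩, ?_, ?_⟩
    · simpa [E.top, ← dom_eq_pre] using h
    · intro e f
      rw [Bool.eq_iff_iff]
      simp only [E.inter, pre_inter, Bool.and_eq_true, decide_eq_true_eq]
      exact ⟨fun h => ⟨h.mono Set.inter_subset_left, h.mono Set.inter_subset_right⟩,
        fun h => h.1.inter h.2⟩
    · intro f S hf
      simp only [decide_eq_true_eq]
      rw [hf]
      constructor
      · intro hm
        by_contra hcon
        push Not at hcon
        have h1 := χ.mem_biInter S (fun e => (pre s.1 e.1)ᶜ) fun e he =>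
          (χ.mem_or_compl (s.2.pre e.isBool)).resolve_left (hcon e he)
        refine hm.not_disjoint h1 ?_
        rw [Set.disjoint_left]
        intro x hx hx'
        simp only [pre_iUnion, Set.mem_iUnion, Set.mem_iInter, exists_prop] at hx hx'
        obtain ⟨e, he, hxe⟩ := hx
        exact hx' e he hxe
      · rintro ⟨e, he, hm⟩
        exact hm.mono (pre_mono _ (Set.subset_biUnion_of_mem (u := fun e : E P => e.1) he))⟩

theorem ext' {χ ψ : Omega P} (h : ∀ e : E P, χ.Mem e.1 ↔ ψ.Mem e.1) : χ = ψ := by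
  refine Omega.ext (funext fun e => ?_)
  rw [Bool.eq_iff_iff, ← mem_iff, ← mem_iff, h]

variable {χ} in
theorem mem_act_of {s : BoolHull P} (h : χ.Mem (dom s.1)) {Y : Set P}
    (hY : (act s χ h).Mem Y) : χ.Mem (pre s.1 Y) := by
  classical
  obtain ⟨e, F, h1, h2, h3⟩ := hY
  have h1' : χ.Mem (pre s.1 e.1) := by simpa [act] using h1
  have h2' := χ.mem_biInter F (fun f => (pre s.1 f.1)ᶜ) fun f hf =>
    (χ.mem_or_compl (s.2.pre f.isBool)).resolve_left (by simpa [act] using h2 f hf)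
  refine (h1'.inter h2').mono (subset_trans ?_ (pre_mono s.1 h3))
  rw [pre_diff]
  rintro x ⟨hx, hx'⟩
  refine ⟨hx, ?_⟩
  simp only [pre_iUnion, Set.mem_iUnion, Set.mem_iInter, exists_prop, not_exists, not_and]
    at hx' ⊢
  exact hx'

variable {χ} in
theorem mem_act {s : BoolHull P} (h : χ.Mem (dom s.1)) {Y : Set P} (hY : IsBool Y) :
    (act s χ h).Mem Y ↔ χ.Mem (pre s.1 Y) := by
  refine ⟨mem_act_of h, fun hm => ((act s χ h).mem_or_compl hY).resolve_right fun hc => ?_⟩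
  refine hm.not_disjoint (mem_act_of h hc) ?_
  rw [Set.disjoint_iff_inter_eq_empty, ← pre_inter]
  ext x
  simp [pre]

/-- The principal character `χ_c`: `χ_c(e) = 1` if `c c⁻¹ ≤ e`, that is, if `c P ⊆ e`, and
`χ_c(e) = 0` otherwise. -/
noncomputable def principal (c : P) : Omega P :=
  ⟨fun e => open Classical in decide (Set.range (fun x => c * x) ⊆ e.1), by
    classical
    have key : ∀ e : E P, Set.range (fun x => c * x) ⊆ e.1 ↔ c ∈ e.1 := fun e =>
      ⟨fun h => h ⟨1, mul_one c⟩, fun h => by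
        rintro _ ⟨x, rfl⟩
        exact e.mul_mem h x⟩
    simp only [key]
    refine ⟨⟨E.top P, by simp [E.top]⟩, ?_, ?_⟩
    · intro e f
      rw [Bool.eq_iff_iff]
      simp [E.inter]
    · intro f S hf
      simp only [decide_eq_true_eq]
      rw [hf]
      simp⟩

theorem principal_mem (c : P) {X : Set P} (hX : IsBool X) (hc : c ∈ X) :
    (principal c).Mem X := by
  classical
  refine ((principal c).mem_or_compl hX).resolve_right ?_
  rintro ⟨e, F, h1, h2, h3⟩
  have h1' : Set.range (fun x => c * x) ⊆ e.1 := by simpa [principal] using h1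
  refine h3 ⟨h1' ⟨1, mul_one c⟩, ?_⟩ hc
  simp only [Set.mem_iUnion, exists_prop, not_exists, not_and]
  intro f hf hcf
  have h2' : ¬ Set.range (fun x => c * x) ⊆ f.1 := by simpa [principal] using h2 f hf
  refine h2' ?_
  rintro _ ⟨x, rfl⟩
  exact f.mul_mem hcf x

end Omega

/-! ### The transformation groupoid `𝒢 = Ī_l ⋉ Ω` -/

variable (P) in
/-- The set `Ī_l * Ω` of pairs `(s, χ)` with `χ(s⁻¹ s) = 1`. -/
abbrev Pairs : Type _ := {p : BoolHull P × Omega P // p.2.Mem (dom p.1.1)}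

/-- `(s, χ) ∼ (t, ψ)` if `χ = ψ` and `s e = t e` for an idempotent `e ∈ Ī_l` (that is,
`e ∈ Ē`) with `χ(e) = 1`. -/
def germRel (p q : Pairs P) : Prop :=
  p.1.2 = q.1.2 ∧ ∃ X, IsBool X ∧ p.1.2.Mem X ∧ restrict p.1.1.1 X = restrict q.1.1.1 X

instance germSetoid : Setoid (Pairs P) where
  r := germRel
  iseqv := by
    refine ⟨fun p => ⟨rfl, Set.univ, (E.top P).isBool, p.1.2.mem_univ, rfl⟩, ?_, ?_⟩
    · rintro p q ⟨h, X, hX, hm, he⟩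
      exact ⟨h.symm, X, hX, h ▸ hm, he.symm⟩
    · rintro p q r ⟨h, X, hX, hm, he⟩ ⟨h', Y, hY, hm', he'⟩
      refine ⟨h.trans h', X ∩ Y, hX.inter hY, hm.inter (h ▸ hm'), ?_⟩
      rw [restrict_eq_iff] at he he' ⊢
      exact fun x hx y => (he x hx.1 y).trans (he' x hx.2 y)

variable (P) in
/-- The transformation groupoid `𝒢 = Ī_l ⋉ Ω`, as the set of all its arrows. -/
def Germ : Type _ := Quotient (germSetoid (P := P))

namespace Germ

/-- The class `[s, χ]`. -/
def mk (s : BoolHull P) (χ : Omega P) (h : χ.Mem (dom s.1)) : Germ P :=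
  Quotient.mk germSetoid ⟨(s, χ), h⟩

theorem mk_eq {s t : BoolHull P} {χ ψ : Omega P} {h : χ.Mem (dom s.1)} {h' : ψ.Mem (dom t.1)}
    (e : χ = ψ) {X : Set P} (hX : IsBool X) (hm : χ.Mem X)
    (hst : ∀ x ∈ X, ∀ y, y ∈ s.1 x ↔ y ∈ t.1 x) : mk s χ h = mk t ψ h' :=
  Quotient.sound ⟨e, X, hX, hm, restrict_eq_iff.2 hst⟩

/-- The source of `[s, χ]` is `χ`. -/
def src : Germ P → Omega P :=
  Quotient.lift (fun p => p.1.2) fun _ _ h => h.1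

/-- The target of `[s, χ]` is `s · χ`. -/
noncomputable def tgt : Germ P → Omega P :=
  Quotient.lift (fun p => Omega.act p.1.1 p.1.2 p.2) (by
    rintro ⟨⟨s, χ⟩, h⟩ ⟨⟨t, ψ⟩, h'⟩ ⟨h1, X, hX, hm, he⟩
    change χ = ψ at h1
    subst h1
    change χ.Mem X at hm
    change restrict s.1 X = restrict t.1 X at he
    refine Omega.ext' fun e => ?_
    rw [Omega.mem_act _ e.isBool, Omega.mem_act _ e.isBool]
    have key : X ∩ pre s.1 e.1 = X ∩ pre t.1 e.1 := by
      rw [← pre_restrict, ← pre_restrict, he]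
    exact ⟨fun h => (key ▸ hm.inter h).mono Set.inter_subset_right,
      fun h => (key.symm ▸ hm.inter h).mono Set.inter_subset_right⟩)

@[simp] theorem src_mk (s : BoolHull P) (χ : Omega P) (h : χ.Mem (dom s.1)) :
    (mk s χ h).src = χ := rfl

@[simp] theorem tgt_mk (s : BoolHull P) (χ : Omega P) (h : χ.Mem (dom s.1)) :
    (mk s χ h).tgt = Omega.act s χ h := rfl

theorem ind {motive : Germ P → Prop} (h : ∀ s χ hs, motive (mk s χ hs)) (g : Germ P) :
    motive g := by
  induction g using Quotient.inductionOn with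
  | h p => exact h p.1.1 p.1.2 p.2

theorem mem_dom_mul {s t : BoolHull P} {χ : Omega P} (ht : χ.Mem (dom t.1))
    (hs : (Omega.act t χ ht).Mem (dom s.1)) : χ.Mem (dom (s.mul t).1) := by
  rw [BoolHull.mul, dom_trans]
  exact (Omega.mem_act ht s.2.dom).1 hs

theorem mem_dom_inv {s : BoolHull P} {χ : Omega P} (hs : χ.Mem (dom s.1)) :
    (Omega.act s χ hs).Mem (dom s.inv.1) := by
  rw [Omega.mem_act hs s.inv.2.dom, BoolHull.inv, pre_symm_dom]
  exact hs

/-- The inverse of `[s, χ]` is `[s⁻¹, s · χ]`. -/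
noncomputable def inv : Germ P → Germ P :=
  Quotient.lift (fun p => mk p.1.1.inv (Omega.act p.1.1 p.1.2 p.2) (mem_dom_inv p.2)) (by
    rintro ⟨⟨s, χ⟩, h⟩ ⟨⟨t, ψ⟩, h'⟩ hr
    have htgt : Omega.act s χ h = Omega.act t ψ h' := congrArg tgt (Quotient.sound hr)
    obtain ⟨h1, X, hX, hm, he⟩ := hr
    change χ = ψ at h1
    subst h1
    change χ.Mem X at hm
    rw [restrict_eq_iff] at he
    change ∀ x ∈ X, ∀ y, y ∈ s.1 x ↔ y ∈ t.1 x at he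
    refine mk_eq (X := pre s.1.symm X ∩ pre t.1.symm X) htgt
      ((s.inv.2.pre hX).inter (t.inv.2.pre hX)) (Omega.Mem.inter ?_ ?_) ?_
    · refine (Omega.mem_act h (s.inv.2.pre hX)).2 ?_
      refine (h.inter hm).mono ?_
      rintro x ⟨⟨y, hy⟩, hxX⟩
      exact ⟨y, hy, x, (PEquiv.mem_iff_mem _).2 hy, hxX⟩
    · rw [htgt]
      refine (Omega.mem_act h' (t.inv.2.pre hX)).2 ?_
      refine (h'.inter hm).mono ?_
      rintro x ⟨⟨y, hy⟩, hxX⟩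
      exact ⟨y, hy, x, (PEquiv.mem_iff_mem _).2 hy, hxX⟩
    · rintro y ⟨⟨x, hx, hxX⟩, ⟨x', hx', hxX'⟩⟩ z
      change z ∈ s.1.symm y ↔ z ∈ t.1.symm y
      constructor
      · intro hz
        obtain rfl := pequiv_fun hx hz
        exact (PEquiv.mem_iff_mem _).2 ((he x hxX y).1 ((PEquiv.mem_iff_mem _).1 hx))
      · intro hz
        obtain rfl := pequiv_fun hx' hz
        exact (PEquiv.mem_iff_mem _).2 ((he x' hxX' y).2 ((PEquiv.mem_iff_mem _).1 hx')))

open Classical in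
/-- The product of `[s, t · χ]` and `[t, χ]` is `[s t, χ]`; pairs that are not composable get a
junk value, which is never used. -/
noncomputable def mul : Germ P → Germ P → Germ P :=
  Quotient.lift₂ (fun p q =>
      if h : p.1.2 = Omega.act q.1.1 q.1.2 q.2 then
        mk (p.1.1.mul q.1.1) q.1.2 (mem_dom_mul q.2 (h ▸ p.2))
      else mk q.1.1 q.1.2 q.2) (by
    rintro ⟨⟨s, ω⟩, hs⟩ ⟨⟨t, χ⟩, ht⟩ ⟨⟨s', ω'⟩, hs'⟩ ⟨⟨t', χ'⟩, ht'⟩ hr hr'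
    have htgt : Omega.act t χ ht = Omega.act t' χ' ht' := congrArg tgt (Quotient.sound hr')
    have hgerm : mk t χ ht = mk t' χ' ht' := Quotient.sound hr'
    obtain ⟨h1, X, hX, hm, he⟩ := hr
    obtain ⟨h2, Y, hY, hn, hf⟩ := hr'
    change ω = ω' at h1
    change χ = χ' at h2
    subst h1 h2
    change ω.Mem X at hm
    change χ.Mem Y at hn
    rw [restrict_eq_iff] at he hf
    change ∀ x ∈ X, ∀ y, y ∈ s.1 x ↔ y ∈ s'.1 x at he
    change ∀ x ∈ Y, ∀ y, y ∈ t.1 x ↔ y ∈ t'.1 x at hf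
    by_cases h : ω = Omega.act t χ ht
    · have h' : ω = Omega.act t' χ ht' := h.trans htgt
      dsimp only
      rw [dif_pos h, dif_pos h']
      refine mk_eq (X := Y ∩ pre t.1 X) rfl (hY.inter (t.2.pre hX))
        (hn.inter ((Omega.mem_act ht hX).1 (h ▸ hm))) ?_
      rintro x ⟨hxY, b, hb, hbX⟩ y
      change y ∈ t.1.trans s.1 x ↔ y ∈ t'.1.trans s'.1 x
      rw [PEquiv.mem_trans, PEquiv.mem_trans]
      constructor
      · rintro ⟨c, hc, hy⟩
        obtain rfl := pequiv_fun hb hc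
        exact ⟨b, (hf x hxY b).1 hb, (he b hbX y).1 hy⟩
      · rintro ⟨c, hc, hy⟩
        obtain rfl := pequiv_fun hb ((hf x hxY c).2 hc)
        exact ⟨b, hb, (he b hbX y).2 hy⟩
    · have h' : ¬ ω = Omega.act t' χ ht' := fun h' => h (h'.trans htgt.symm)
      dsimp only
      rw [dif_neg h, dif_neg h']
      exact hgerm)

theorem mul_mk {s t : BoolHull P} {ω χ : Omega P} (hs : ω.Mem (dom s.1)) (ht : χ.Mem (dom t.1))
    (h : ω = Omega.act t χ ht) :
    mul (mk s ω hs) (mk t χ ht) = mk (s.mul t) χ (mem_dom_mul ht (h ▸ hs)) :=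
  dif_pos h

theorem act_mul {s t : BoolHull P} {χ : Omega P} (ht : χ.Mem (dom t.1))
    (hs : (Omega.act t χ ht).Mem (dom s.1)) (hst : χ.Mem (dom (s.mul t).1)) :
    Omega.act (s.mul t) χ hst = Omega.act s (Omega.act t χ ht) hs := by
  refine Omega.ext' fun e => ?_
  rw [Omega.mem_act _ e.isBool, Omega.mem_act _ e.isBool, Omega.mem_act _ (s.2.pre e.isBool),
    BoolHull.mul, pre_trans]

theorem act_inv {s : BoolHull P} {χ : Omega P} (hs : χ.Mem (dom s.1)) :
    Omega.act s.inv (Omega.act s χ hs) (mem_dom_inv hs) = χ := by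
  refine Omega.ext' fun e => ?_
  rw [Omega.mem_act _ e.isBool, Omega.mem_act _ (s.inv.2.pre e.isBool)]
  constructor
  · refine fun h => h.mono ?_
    rintro x ⟨y, hy, z, hz, hze⟩
    obtain rfl := PEquiv.inj s.1 hy ((PEquiv.mem_iff_mem s.1).1 hz)
    exact hze
  · refine fun h => (h.inter hs).mono ?_
    rintro x ⟨hx, y, hy⟩
    exact ⟨y, hy, x, (PEquiv.mem_iff_mem s.1).2 hy, hx⟩

theorem mem_dom_one (χ : Omega P) : χ.Mem (dom (BoolHull.one P).1) := by
  rw [BoolHull.one, dom_eq_pre, pre_idem, Set.univ_inter]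
  exact χ.mem_univ

/-- The unit at `χ`. -/
noncomputable def unit (χ : Omega P) : Germ P := mk (BoolHull.one P) χ (mem_dom_one χ)

theorem act_one (χ : Omega P) : Omega.act (BoolHull.one P) χ (mem_dom_one χ) = χ := by
  refine Omega.ext' fun e => ?_
  rw [Omega.mem_act _ e.isBool, BoolHull.one, pre_idem, Set.univ_inter]

theorem tgt_unit (χ : Omega P) : (unit χ).tgt = χ := act_one χ

theorem src_mul {g h : Germ P} (H : g.src = h.tgt) : (mul g h).src = h.src := by
  induction g using Germ.ind with | h s ω hs => ?_
  induction h using Germ.ind with | h t χ ht => ?_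
  rw [mul_mk hs ht H]
  rfl

theorem tgt_mul {g h : Germ P} (H : g.src = h.tgt) : (mul g h).tgt = g.tgt := by
  induction g using Germ.ind with | h s ω hs => ?_
  induction h using Germ.ind with | h t χ ht => ?_
  change ω = Omega.act t χ ht at H
  subst H
  rw [mul_mk _ _ rfl, tgt_mk, tgt_mk, act_mul ht hs]

theorem src_inv (g : Germ P) : g.inv.src = g.tgt := by
  induction g using Germ.ind
  rfl

theorem tgt_inv (g : Germ P) : g.inv.tgt = g.src := by
  induction g using Germ.ind with | h s χ hs => ?_
  exact act_inv hs

theorem unit_mul (g : Germ P) : mul (unit g.tgt) g = g := by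
  induction g using Germ.ind with | h s χ hs => ?_
  refine (mul_mk _ _ rfl).trans (mk_eq rfl (E.top P).isBool χ.mem_univ fun x _ y => ?_)
  change y ∈ s.1.trans (idem Set.univ) x ↔ _
  rw [PEquiv.mem_trans]
  simp only [mem_idem, Set.mem_univ, and_true, exists_eq_right']

theorem mul_unit (g : Germ P) : mul g (unit g.src) = g := by
  induction g using Germ.ind with | h s χ hs => ?_
  refine (mul_mk _ _ (act_one χ).symm).trans
    (mk_eq rfl (E.top P).isBool χ.mem_univ fun x _ y => ?_)
  change y ∈ (idem Set.univ).trans s.1 x ↔ _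
  rw [PEquiv.mem_trans]
  simp only [mem_idem, Set.mem_univ, and_true, exists_eq_left]

theorem inv_mul (g : Germ P) : mul g.inv g = unit g.src := by
  induction g using Germ.ind with | h s χ hs => ?_
  refine (mul_mk _ _ rfl).trans (mk_eq rfl s.2.dom hs fun x hx y => ?_)
  change y ∈ s.1.trans s.1.symm x ↔ y ∈ idem Set.univ x
  rw [PEquiv.mem_trans]
  simp only [mem_idem, Set.mem_univ, and_true]
  obtain ⟨b, hb⟩ := hx
  constructor
  · rintro ⟨c, hc, hy⟩
    exact PEquiv.inj s.1 ((PEquiv.mem_iff_mem s.1).1 hy) hc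
  · rintro rfl
    exact ⟨b, hb, (PEquiv.mem_iff_mem s.1).2 hb⟩

theorem mul_inv (g : Germ P) : mul g g.inv = unit g.tgt := by
  induction g using Germ.ind with | h s χ hs => ?_
  refine (mul_mk _ _ (act_inv hs).symm).trans
    (mk_eq rfl s.inv.2.dom (mem_dom_inv hs) fun x hx y => ?_)
  change y ∈ s.1.symm.trans s.1 x ↔ y ∈ idem Set.univ x
  rw [PEquiv.mem_trans]
  simp only [mem_idem, Set.mem_univ, and_true]
  obtain ⟨b, hb⟩ := hx
  constructor
  · rintro ⟨c, hc, hy⟩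
    exact pequiv_fun hy ((PEquiv.mem_iff_mem s.1).1 hc)
  · rintro rfl
    exact ⟨b, hb, (PEquiv.mem_iff_mem s.1).1 hb⟩

theorem mul_assoc {f g h : Germ P} (H : f.src = g.tgt) (H' : g.src = h.tgt) :
    mul (mul f g) h = mul f (mul g h) := by
  induction f using Germ.ind with | h r ω hr => ?_
  induction g using Germ.ind with | h s ψ hs => ?_
  induction h using Germ.ind with | h t χ ht => ?_
  change ω = Omega.act s ψ hs at H
  change ψ = Omega.act t χ ht at H'
  subst H
  subst H'
  rw [mul_mk hr hs rfl, mul_mk hs ht rfl, mul_mk _ ht rfl,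
    mul_mk hr _ (act_mul ht hs (mem_dom_mul ht hs)).symm]
  refine mk_eq rfl (E.top P).isBool χ.mem_univ fun x _ y => ?_
  change y ∈ t.1.trans (s.1.trans r.1) x ↔ y ∈ (t.1.trans s.1).trans r.1 x
  rw [PEquiv.trans_assoc]

end Germ

/-- `𝒢 = Ī_l ⋉ Ω` as a groupoid with unit space `Ω`: the arrows `χ ⟶ ψ` are the germs with source
`χ` and target `ψ`, and `h ≫ g` is the product `g h`. -/
noncomputable instance germGroupoid : CategoryTheory.Groupoid (Omega P) where
  Hom χ ψ := {g : Germ P // g.src = χ ∧ g.tgt = ψ}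
  id χ := ⟨Germ.unit χ, rfl, Germ.tgt_unit χ⟩
  comp h g := ⟨Germ.mul g.1 h.1,
    (Germ.src_mul (g.2.1.trans h.2.2.symm)).trans h.2.1,
    (Germ.tgt_mul (g.2.1.trans h.2.2.symm)).trans g.2.2⟩
  inv g := ⟨g.1.inv, g.1.src_inv.trans g.2.2, g.1.tgt_inv.trans g.2.1⟩
  id_comp := by
    rintro χ ψ ⟨g, rfl, rfl⟩
    exact Subtype.ext g.mul_unit
  comp_id := by
    rintro χ ψ ⟨g, rfl, rfl⟩
    exact Subtype.ext g.unit_mul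
  assoc f g h := Subtype.ext
    (Germ.mul_assoc (h.2.1.trans g.2.2.symm) (g.2.1.trans f.2.2.symm)).symm
  inv_comp := by
    rintro χ ψ ⟨g, rfl, rfl⟩
    exact Subtype.ext g.mul_inv
  comp_inv := by
    rintro χ ψ ⟨g, rfl, rfl⟩
    exact Subtype.ext g.inv_mul

/-- The topology of `𝒢`, with basis the sets `[s, U]`, `s ∈ Ī_l`, `U ⊆ D_{s⁻¹ s}` open. -/
instance : TopologicalSpace (Germ P) :=
  TopologicalSpace.generateFrom
    {W | ∃ (s : BoolHull P) (U : Set (Omega P)) (hU : ∀ χ ∈ U, χ.Mem (dom s.1)),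
      IsOpen U ∧ W = {g | ∃ (χ : Omega P) (h : χ ∈ U), g = Germ.mk s χ (hU χ h)}}

variable (P) in
/-- The isotropy `Iso(𝒢)`. -/
def isotropy : Set (Germ P) := {g | g.src = g.tgt}

theorem mem_dom_leftMul (c : P) (χ : Omega P) : χ.Mem (dom (leftMul c)) :=
  χ.mem_univ.mono fun x _ => ⟨c * x, mem_leftMul.2 rfl⟩

variable (P) in
/-- The subgroupoid `P* ⋉ Ω` of all germs `[u, χ]` with `u` invertible in `P`. -/
def unitGerms : Set (Germ P) :=
  {g | ∃ (u : Pˣ) (χ : Omega P),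
    g = Germ.mk (.ofHull (.leftMul (u : P))) χ (mem_dom_leftMul (u : P) χ)}

/-- The element `c v c⁻¹` of the left inverse hull, where `c`, `v` in `P` stand for the
corresponding left multiplication maps. -/
noncomputable def conj (c v : P) : P ≃. P :=
  ((leftMul c).symm.trans (leftMul v)).trans (leftMul c)

theorem inHull_conj (c v : P) : InHull (conj c v) :=
  ((InHull.leftMul c).symm.trans (.leftMul v)).trans (.leftMul c)

theorem mem_conj {c v x y : P} : y ∈ conj c v x ↔ ∃ z, x = c * z ∧ y = c * (v * z) := by
  simp only [conj, PEquiv.mem_trans, PEquiv.mem_iff_mem, mem_leftMul]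
  constructor
  · rintro ⟨_, ⟨z, rfl, rfl⟩, rfl⟩
    exact ⟨z, rfl, rfl⟩
  · rintro ⟨z, rfl, rfl⟩
    exact ⟨v * z, ⟨z, rfl, rfl⟩, rfl⟩

theorem mem_dom_conj (c v : P) : (Omega.principal c).Mem (dom (conj c v)) :=
  Omega.principal_mem c (inHull_conj c v).inBoolHull.dom
    ⟨c * (v * 1), mem_conj.2 ⟨1, (mul_one c).symm, rfl⟩⟩

/-- The germ `[c v c⁻¹, χ_c]`. -/
noncomputable def conjGerm (c v : P) : Germ P :=
  Germ.mk (.ofHull (inHull_conj c v)) (Omega.principal c) (mem_dom_conj c v)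

/-! ### Reduced C*-algebras -/

variable (P) in
/-- The Hilbert space `ℓ²(𝒢) = ⨁_χ ℓ²(𝒢_χ)`, where `𝒢_χ` is the set of germs with source `χ`. -/
abbrev L2 : Type _ := lp (fun _ : Germ P => ℂ) 2

open CategoryTheory in
open Classical in
/-- `T = λ(f)`, where `λ = ⨁_χ λ_χ` is the direct sum of the left regular representations
`(λ_χ(f) ξ)(g) = ∑_{h ∈ 𝒢_χ} f(g h⁻¹) ξ(h)`, expressed through the matrix coefficients
`⟨T δ_h, δ_g⟩`: they are `f(g h⁻¹)` if `g` and `h` have the same source, and `0` otherwise. -/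
def IsRegularRep (f : Germ P → ℂ) (T : L2 P →L[ℂ] L2 P) : Prop :=
  (∀ (χ ψ ω : Omega P) (g : χ ⟶ ω) (h : χ ⟶ ψ),
    T (lp.single 2 h.1 (1 : ℂ)) g.1 = f (Groupoid.inv h ≫ g).1) ∧
  ∀ g h : Germ P, g.src ≠ h.src → T (lp.single 2 h (1 : ℂ)) g = 0

/-- For an open subgroupoid `H` of the (Hausdorff) groupoid `𝒢`, the C*-subalgebra `C*_r(H)` of
`C*_r(𝒢) ⊆ B(ℓ²(𝒢))`: the norm closure of the operators `λ(f)`, `f ∈ C_c(H)`, where functions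
on `H` are extended by zero to `𝒢`. -/
def reducedAlgebra (H : Set (Germ P)) : Set (L2 P →L[ℂ] L2 P) :=
  closure {T | ∃ f : Germ P → ℂ, Continuous f ∧ HasCompactSupport f ∧ tsupport f ⊆ H ∧
    IsRegularRep f T}

end LeftHull

/-! ### The monoid `ℕ^× ⋉ ℤ/nℤ` -/

/-- The semidirect product `ℕ^× ⋉ ℤ/nℤ`, with `(a, [k]) (b, [l]) = (a b, [k b + l])`. -/
@[ext] structure NatSemiZMod (n : ℕ+) where
  /-- The component in `ℕ^×`. -/
  fst : ℕ+
  /-- The component in `ℤ/nℤ`. -/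
  snd : ZMod n

noncomputable instance (n : ℕ+) : LeftCancelMonoid (NatSemiZMod n) where
  mul p q := ⟨p.fst * q.fst, p.snd * ((q.fst : ℕ) : ZMod n) + q.snd⟩
  one := ⟨1, 0⟩
  mul_assoc p q r := by
    refine NatSemiZMod.ext (_root_.mul_assoc p.fst q.fst r.fst) ?_
    change (p.snd * ((q.fst : ℕ) : ZMod n) + q.snd) * ((r.fst : ℕ) : ZMod n) + r.snd =
      p.snd * (((q.fst * r.fst : ℕ+) : ℕ) : ZMod n) + (q.snd * ((r.fst : ℕ) : ZMod n) + r.snd)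
    push_cast
    ring
  one_mul p := by
    refine NatSemiZMod.ext (one_mul p.fst) ?_
    change (0 : ZMod n) * ((p.fst : ℕ) : ZMod n) + p.snd = p.snd
    ring
  mul_one p := by
    refine NatSemiZMod.ext (mul_one p.fst) ?_
    change p.snd * (((1 : ℕ+) : ℕ) : ZMod n) + 0 = p.snd
    simp
  mul_left_cancel p q r h := by
    obtain ⟨h1, h2⟩ := NatSemiZMod.ext_iff.1 h
    have h1' : q.fst = r.fst := mul_left_cancel (a := p.fst) h1
    refine NatSemiZMod.ext h1' ?_
    change p.snd * ((q.fst : ℕ) : ZMod n) + q.snd = p.snd * ((r.fst : ℕ) : ZMod n) + r.snd at h2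
    rw [h1'] at h2
    exact add_left_cancel h2

end Hull

namespace Hull

/-! ### Topology of `Ω` and of the groupoid of germs -/

section Topology

variable {P : Type*} [LeftCancelMonoid P]

/-! Write `P` for the monoid. Every set in `E` is a right ideal of `P`, and right multiplication by
(1,[j]) moves (a,[l]) to (a,[l+j]). A set in `E` is therefore a union of fibres of the first
coordinate (`mem_of_fst_eq`), and a partial bijection that preserves the first coordinate fixes
every character in its domain (`act_eq_self`). All its germs are isotropy, and they form an open
set, so they lie in the interior of the isotropy. This applies to left multiplication by units,
whose first coordinate is 1, and to s = (n,[0])(1,[1])(n,[0])⁻¹, which sends (nb,[l]) to (nb,[l+b]).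

The germ of s at the principal character of (n,[0]) is not a unit germ. Equality of germs at a
principal character forces the two maps to agree at the point itself, but s sends (n,[0]) to
(n,[1]), while a unit (1,[k]) sends it to (n,[kn]) = (n,[0]). These differ because n > 1.

For the algebras, the coefficient of an operator at a germ outside H is norm continuous and vanishes
on C*_r(H). The operator of the indicator of the bisection of s has coefficient 1 at the germ above.
It remains to see that this indicator is in C_c of the isotropy interior, so the bisection has to be
compact, open and closed. Closedness requires the agreement set of s with any other element to lie
in Ē (`isBool_agree`). This follows from a normal form for the hull (`exists_form`), which makes
every fixed-point set either empty or a set of multiples. -/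

theorem isBool_empty : IsBool (∅ : Set P) :=
  ⟨0, Fin.elim0, Fin.elim0, fun i => i.elim0, by simp⟩

namespace Omega

/-- Each defining condition involves only finitely many coordinates, so it is clopen in the compact
product of copies of {0,1}. Compactness of Ω follows. -/
theorem isClosedEmbedding_toFun : Topology.IsClosedEmbedding (Omega.toFun (P := P)) := by
  refine ⟨⟨⟨rfl⟩, fun χ ψ h => Omega.ext h⟩, ?_⟩
  -- Being nonzero is not by itself a closed condition. For multiplicative maps it is equivalent to
  -- the value 1 at the identity, which is closed.
  have hrange : Set.range (Omega.toFun (P := P)) =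
      {χ | χ (E.top P) = true} ∩ (⋂ (e : E P) (f : E P), {χ | χ (E.inter e f) = (χ e && χ f)}) ∩
        ⋂ (f : E P) (S : Finset (E P)) (_ : f.1 = ⋃ e ∈ S, e.1),
          {χ | χ f = true ↔ ∃ e ∈ S, χ e = true} := by
    ext χ
    simp only [Set.mem_inter_iff, Set.mem_iInter, Set.mem_ofPred_eq]
    constructor
    · rintro ⟨ψ, rfl⟩
      exact ⟨⟨(ψ.mem_iff _).1 ψ.mem_univ, ψ.2.mul⟩, ψ.2.union⟩
    · rintro ⟨⟨h1, h2⟩, h3⟩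
      exact ⟨⟨χ, ⟨_, h1⟩, h2, h3⟩, rfl⟩
  rw [hrange]
  have hev : ∀ e : E P, Continuous fun χ : E P → Bool => χ e := fun e => continuous_apply e
  refine ((isClosed_eq (hev _) continuous_const).inter
    (isClosed_iInter fun e => isClosed_iInter fun f => isClosed_eq (hev _) ?_)).inter
    (isClosed_iInter fun f => isClosed_iInter fun S => isClosed_iInter fun _ => ?_)
  · exact (continuous_of_discreteTopology (f := fun b : Bool × Bool => b.1 && b.2)).comp
      ((hev e).prodMk (hev f))
  · have hclopen : ∀ e : E P, IsClopen {χ : E P → Bool | χ e = true} := fun e =>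
      (isClopen_discrete {true}).preimage (hev e)
    have hS : IsClopen {χ : E P → Bool | ∃ e ∈ S, χ e = true} := by
      have := S.finite_toSet.isClopen_biUnion fun e _ => hclopen e
      convert this using 1
      ext χ
      simp
    have h : {χ : E P → Bool | χ f = true ↔ ∃ e ∈ S, χ e = true} =
        ({χ | χ f = true} ∩ {χ | ∃ e ∈ S, χ e = true}) ∪
          ({χ | χ f = true}ᶜ ∩ {χ | ∃ e ∈ S, χ e = true}ᶜ) := by
      ext χ
      exact iff_iff_and_or_not_and_not
    rw [h]
    exact (((hclopen f).inter hS).union ((hclopen f).compl.inter hS.compl)).1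

instance : CompactSpace (Omega P) := isClosedEmbedding_toFun.compactSpace

/-- A witness e \ ⋃ f for χ constrains finitely many coordinates and so serves all nearby
characters. No Boolean hypothesis on X is needed; it enters only for closedness. -/
theorem isOpen_mem (X : Set P) : IsOpen {χ : Omega P | χ.Mem X} := by
  have hev : ∀ (e : E P) (b : Bool), IsOpen {χ : Omega P | χ.1 e = b} := fun e b =>
    (isOpen_discrete {b}).preimage
      ((continuous_apply e).comp isClosedEmbedding_toFun.continuous)
  rw [isOpen_iff_mem_nhds]
  rintro χ ⟨e, F, h1, h2, h3⟩
  filter_upwards [(hev e true).mem_nhds h1,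
    (F.finite_toSet.isOpen_biInter fun f _ => hev f false).mem_nhds (by simpa using h2)]
    with ψ hψ hψ'
  exact ⟨e, F, hψ, by simpa using hψ', h3⟩

theorem mem_compl_iff (χ : Omega P) {X : Set P} (hX : IsBool X) : χ.Mem Xᶜ ↔ ¬ χ.Mem X :=
  ⟨fun h h' => h'.not_disjoint h disjoint_compl_right, (χ.mem_or_compl hX).resolve_left⟩

theorem isClopen_mem {X : Set P} (hX : IsBool X) : IsClopen {χ : Omega P | χ.Mem X} := by
  refine ⟨⟨?_⟩, isOpen_mem X⟩
  convert isOpen_mem Xᶜ using 1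
  ext χ
  exact (χ.mem_compl_iff hX).symm

/-- Sets in `E` are right ideals, so cP ⊆ e just when c ∈ e. The extended principal character is
thus evaluation at the point c, which reduces equality of germs there to a pointwise question. -/
theorem principal_mem_iff (c : P) {X : Set P} (hX : IsBool X) :
    (principal c).Mem X ↔ c ∈ X := by
  refine ⟨fun h => ?_, principal_mem c hX⟩
  obtain ⟨e, F, h1, h2, h3⟩ := h
  have h1' : Set.range (fun x => c * x) ⊆ e.1 := by simpa [principal] using h1
  refine h3 ⟨h1' ⟨1, mul_one c⟩, ?_⟩
  simp only [Set.mem_iUnion, exists_prop, not_exists, not_and]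
  intro f hf hcf
  have h2' : ¬ Set.range (fun x => c * x) ⊆ f.1 := by simpa [principal] using h2 f hf
  refine h2' ?_
  rintro _ ⟨x, rfl⟩
  exact f.mul_mem hcf x

end Omega

/-! ### Open bisections: compactness and closedness -/

namespace Germ

theorem mk_eq_iff {s t : BoolHull P} {χ ψ : Omega P} {h : χ.Mem (dom s.1)}
    {h' : ψ.Mem (dom t.1)} :
    mk s χ h = mk t ψ h' ↔
      χ = ψ ∧ ∃ X, IsBool X ∧ χ.Mem X ∧ ∀ x ∈ X, ∀ y, y ∈ s.1 x ↔ y ∈ t.1 x := by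
  constructor
  · intro H
    obtain ⟨h1, X, hX, hm, he⟩ := Quotient.exact H
    exact ⟨h1, X, hX, hm, restrict_eq_iff.1 he⟩
  · rintro ⟨h1, X, hX, hm, he⟩
    exact mk_eq h1 hX hm he

/-- The open bisection of all germs of `s`. -/
def bisection (s : BoolHull P) : Set (Germ P) := {g | ∃ χ h, g = mk s χ h}

theorem mk_mem_bisection (s : BoolHull P) (χ : Omega P) (h : χ.Mem (dom s.1)) :
    mk s χ h ∈ bisection s := ⟨χ, h, rfl⟩

theorem isOpen_basic {s : BoolHull P} {U : Set (Omega P)} (hU : ∀ χ ∈ U, χ.Mem (dom s.1))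
    (ho : IsOpen U) : IsOpen {g | ∃ (χ : Omega P) (h : χ ∈ U), g = mk s χ (hU χ h)} :=
  TopologicalSpace.isOpen_generateFrom_of_mem ⟨s, U, hU, ho, rfl⟩

theorem isOpen_bisection (s : BoolHull P) : IsOpen (bisection s) :=
  isOpen_basic (s := s) (U := {χ | χ.Mem (dom s.1)}) (fun _ h => h) (Omega.isOpen_mem _)

/-- If s and t have the same germ at χ because they agree on X, the same X works for every character
containing X, and these form an open set. -/
theorem continuous_mk (s : BoolHull P) :
    Continuous fun χ : {χ : Omega P // χ.Mem (dom s.1)} => mk s χ.1 χ.2 := by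
  refine continuous_generateFrom_iff.2 ?_
  rintro _ ⟨t, V, hV, hVo, rfl⟩
  rw [isOpen_iff_mem_nhds]
  rintro ⟨χ, hχ⟩ ⟨ψ, hψ, he⟩
  obtain ⟨rfl, X, hX, hm, hst⟩ := mk_eq_iff.1 he
  filter_upwards [continuous_subtype_val.continuousAt.preimage_mem_nhds (hVo.mem_nhds hψ),
    continuous_subtype_val.continuousAt.preimage_mem_nhds
      ((Omega.isOpen_mem X).mem_nhds hm)] with ω h1 h2
  exact ⟨ω.1, h1, mk_eq rfl hX h2 hst⟩

theorem isCompact_bisection (s : BoolHull P) : IsCompact (bisection s) := by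
  have hc : CompactSpace {χ : Omega P // χ.Mem (dom s.1)} :=
    isCompact_iff_compactSpace.1 (Omega.isClopen_mem s.2.dom).1.isCompact
  convert isCompact_range (continuous_mk s) using 1
  ext g
  constructor
  · rintro ⟨χ, h, rfl⟩
    exact ⟨⟨χ, h⟩, rfl⟩
  · rintro ⟨⟨χ, h⟩, rfl⟩
    exact ⟨χ, h, rfl⟩

/-- The set on which two partial bijections are both defined and agree. -/
def agree (s t : P ≃. P) : Set P := {x | ∃ y, y ∈ s x ∧ y ∈ t x}

/-- A germ of t at χ is a germ of s exactly when χ contains the agreement set. When that set lies in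
Ē, a character missing it contains its complement, an open condition. This is the Hausdorff-type
input. -/
theorem isClosed_bisection {s : BoolHull P} (hs : ∀ t : BoolHull P, IsBool (agree s.1 t.1)) :
    IsClosed (bisection s) := by
  refine ⟨?_⟩
  rw [isOpen_iff_forall_mem_open]
  intro g
  induction g using Germ.ind with | h t χ ht => ?_
  intro hg
  have hA : ¬ χ.Mem (agree s.1 t.1) := fun h => hg
    ⟨χ, h.mono fun x ⟨y, hy, _⟩ => ⟨y, hy⟩, mk_eq rfl (hs t) h fun x ⟨z, hz, hz'⟩ y =>
      ⟨fun h => pequiv_fun hz' h ▸ hz, fun h => pequiv_fun hz h ▸ hz'⟩⟩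
  -- The separating neighbourhood consists of the germs of t at characters containing the complement
  -- of the agreement set.
  refine ⟨_, ?_, isOpen_basic (s := t) (U := {ψ | ψ.Mem (dom t.1)} ∩ {ψ | ψ.Mem (agree s.1 t.1)ᶜ})
    (fun _ h => h.1) ((Omega.isOpen_mem _).inter (Omega.isOpen_mem _)),
    ⟨χ, ⟨ht, (χ.mem_compl_iff (hs t)).2 hA⟩, rfl⟩⟩
  rintro _ ⟨ψ, hψ, rfl⟩ ⟨ω, hω, he⟩
  obtain ⟨rfl, X, hX, hm, hst⟩ := mk_eq_iff.1 he
  refine ((hm.inter hω).not_disjoint hψ.2) (Set.disjoint_left.2 ?_)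
  rintro x ⟨hx, y, hy⟩ hxA
  exact hxA ⟨y, hy, (hst x hx y).2 hy⟩

theorem bisection_subset_interior_isotropy {s : BoolHull P}
    (hs : ∀ χ h, Omega.act s χ h = χ) : bisection s ⊆ interior (isotropy P) := by
  refine interior_maximal ?_ (isOpen_bisection s)
  rintro _ ⟨χ, h, rfl⟩
  exact (hs χ h).symm

end Germ

end Topology

/-! ### The regular representation of a bisection -/

section Representation

/-- The contraction `(T ξ) i = ξ (σ i)` for `i ∈ A` and `(T ξ) i = 0` otherwise, on `ℓ²`, where
`σ` is injective on `A`. -/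
theorem exists_lp_comp {ι : Type*} (A : Set ι) (σ : ι → ι) (hσ : Set.InjOn σ A) :
    ∃ T : lp (fun _ : ι => ℂ) 2 →L[ℂ] lp (fun _ : ι => ℂ) 2,
      ∀ ξ, (∀ i ∈ A, T ξ i = ξ (σ i)) ∧ ∀ i ∉ A, T ξ i = 0 := by
  classical
  have hp : 0 < (2 : ENNReal).toReal := by norm_num
  -- Injectivity of σ on A turns a partial sum for T ξ into a sum of distinct terms of ξ. This gives
  -- both square summability and the norm bound 1.
  have key : ∀ (ξ : lp (fun _ : ι => ℂ) 2) (S : Finset ι),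
      ∑ i ∈ S, ‖A.indicator (fun i => ξ (σ i)) i‖ ^ (2 : ENNReal).toReal ≤
        ‖ξ‖ ^ (2 : ENNReal).toReal := by
    intro ξ S
    calc ∑ i ∈ S, ‖A.indicator (fun i => ξ (σ i)) i‖ ^ (2 : ENNReal).toReal
        = ∑ i ∈ S with i ∈ A, ‖ξ (σ i)‖ ^ (2 : ENNReal).toReal := by
          rw [Finset.sum_filter]
          refine Finset.sum_congr rfl fun i _ => ?_
          by_cases hi : i ∈ A
          · simp [hi]
          · simp [hi]
      _ = ∑ j ∈ (S.filter (· ∈ A)).image σ, ‖ξ j‖ ^ (2 : ENNReal).toReal := by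
          rw [Finset.sum_image]
          exact fun i hi j hj h => hσ (Finset.mem_filter.1 hi).2 (Finset.mem_filter.1 hj).2 h
      _ ≤ _ := lp.sum_rpow_le_norm_rpow hp ξ _
  let L : lp (fun _ : ι => ℂ) 2 →ₗ[ℂ] lp (fun _ : ι => ℂ) 2 :=
    { toFun := fun ξ => ⟨A.indicator fun i => ξ (σ i), memℓp_gen' (key ξ)⟩
      map_add' := fun ξ η => lp.ext (Set.indicator_add A _ _)
      map_smul' := fun c ξ => lp.ext (Set.indicator_const_smul A c fun i => ξ (σ i)) }
  refine ⟨L.mkContinuous 1 fun ξ => ?_, fun ξ => ⟨fun i hi => ?_, fun i hi => ?_⟩⟩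
  · rw [one_mul]
    exact lp.norm_le_of_forall_sum_le hp (norm_nonneg ξ) (key ξ)
  · exact Set.indicator_of_mem hi fun i => ξ (σ i)
  · exact Set.indicator_of_notMem hi fun i => ξ (σ i)

variable {P : Type*} [LeftCancelMonoid P]

open CategoryTheory in
-- Since s fixes characters, its germ at χ is a loop w. Convolution by the indicator is (T ξ)(g) =
-- ξ(w⁻¹ g), with w taken at the target of g, and 0 when that target is outside the domain of s.
-- Left translation is injective, so T is a contraction.
theorem exists_isRegularRep_bisection {s : BoolHull P} (hs : ∀ χ h, Omega.act s χ h = χ) :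
    ∃ T, IsRegularRep ((Germ.bisection s).indicator fun _ => (1 : ℂ)) T := by
  classical
  let A : Set (Germ P) := {g | g.tgt.Mem (dom s.1)}
  let w : ∀ χ : Omega P, χ.Mem (dom s.1) → (χ ⟶ χ) := fun χ h => ⟨Germ.mk s χ h, rfl, hs χ h⟩
  let σ : Germ P → Germ P := fun g =>
    if h : g ∈ A then Germ.mul (w g.tgt h).1.inv g else g
  have hσ : ∀ {χ ψ : Omega P} (g : χ ⟶ ψ) (h : ψ.Mem (dom s.1)),
      σ g.1 = (g ≫ Groupoid.inv (w ψ h)).1 := by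
    rintro χ ψ ⟨g, rfl, rfl⟩ h
    exact dif_pos h
  -- The endpoints are kept as variables so that their equalities can be substituted before
  -- cancelling in the groupoid.
  have cancel : ∀ {χ ψ χ' ψ' : Omega P} (a : χ ⟶ ψ) (b : χ' ⟶ ψ') (h : ψ.Mem (dom s.1))
      (h' : ψ'.Mem (dom s.1)), χ = χ' → ψ = ψ' →
      (a ≫ Groupoid.inv (w ψ h)).1 = (b ≫ Groupoid.inv (w ψ' h')).1 → a.1 = b.1 := by
    rintro χ ψ _ _ a b h h' rfl rfl he
    exact congrArg Subtype.val ((cancel_mono (Groupoid.inv (w ψ h))).1 (Subtype.ext he))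
  have hinj : Set.InjOn σ A := by
    intro g hg g' hg' he
    have h1 := hσ (⟨g, rfl, rfl⟩ : g.src ⟶ g.tgt) hg
    have h2 := hσ (⟨g', rfl, rfl⟩ : g'.src ⟶ g'.tgt) hg'
    have h3 := h1.symm.trans (he.trans h2)
    have hsrc : g.src = g'.src := by
      have := congrArg Germ.src h3
      rwa [((⟨g, rfl, rfl⟩ : g.src ⟶ g.tgt) ≫ Groupoid.inv (w _ hg)).2.1,
        ((⟨g', rfl, rfl⟩ : g'.src ⟶ g'.tgt) ≫ Groupoid.inv (w _ hg')).2.1] at this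
    have htgt : g.tgt = g'.tgt := by
      have := congrArg Germ.tgt h3
      rwa [((⟨g, rfl, rfl⟩ : g.src ⟶ g.tgt) ≫ Groupoid.inv (w _ hg)).2.2,
        ((⟨g', rfl, rfl⟩ : g'.src ⟶ g'.tgt) ≫ Groupoid.inv (w _ hg')).2.2] at this
    exact cancel _ _ hg hg' hsrc htgt h3
  obtain ⟨T, hT⟩ := exists_lp_comp A σ hinj
  refine ⟨T, fun χ ψ ω g h => ?_, fun g h hgh => ?_⟩
  · by_cases hω : ω.Mem (dom s.1)
    · have hgA : g.1 ∈ A := by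
        change g.1.tgt.Mem _
        rwa [g.2.2]
      rw [(hT _).1 _ hgA, hσ g hω, lp.single_apply, Pi.single_apply]
      -- In product notation: w⁻¹ g = h if and only if g h⁻¹ = w.
      have : (g ≫ Groupoid.inv (w ω hω)).1 = h.1 ↔
          (Groupoid.inv h ≫ g).1 ∈ Germ.bisection s := by
        constructor
        · intro he
          have hψ : ω = ψ := by
            rw [← (g ≫ Groupoid.inv (w ω hω)).2.2, he, h.2.2]
          subst hψ
          have he' : g ≫ Groupoid.inv (w ω hω) = h := Subtype.ext he
          refine ⟨ω, hω, ?_⟩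
          change _ = (w ω hω).1
          rw [← he']
          simp
        · rintro ⟨ρ, hρ, he⟩
          have h1 : ρ = ψ := by
            rw [← (Groupoid.inv h ≫ g).2.1, he]
            rfl
          have h2 : ρ = ω := by
            rw [← (Groupoid.inv h ≫ g).2.2, he, Germ.tgt_mk, hs]
          subst h1 h2
          have he' : Groupoid.inv h ≫ g = w ρ hω := Subtype.ext he
          rw [← he']
          simp
      by_cases hm : (Groupoid.inv h ≫ g).1 ∈ Germ.bisection s
      · rw [if_pos (this.2 hm), Set.indicator_of_mem hm]
      · rw [if_neg fun hc => hm (this.1 hc), Set.indicator_of_notMem hm]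
    · have hgA : g.1 ∉ A := by
        change ¬ g.1.tgt.Mem _
        rwa [g.2.2]
      rw [(hT _).2 _ hgA, Set.indicator_of_notMem]
      rintro ⟨ρ, hρ, he⟩
      refine hω ?_
      rwa [← (Groupoid.inv h ≫ g).2.2, he, Germ.tgt_mk, hs]
  · by_cases hgA : g ∈ A
    · rw [(hT _).1 _ hgA, lp.single_apply, Pi.single_eq_of_ne]
      rintro rfl
      refine hgh ?_
      rw [hσ (⟨g, rfl, rfl⟩ : g.src ⟶ g.tgt) hgA]
      exact ((⟨g, rfl, rfl⟩ : g.src ⟶ g.tgt) ≫ Groupoid.inv (w _ hgA)).2.1.symm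
    · exact (hT _).2 _ hgA

/-! ### Separating reduced algebras by a matrix coefficient -/

theorem reducedAlgebra_mono {H K : Set (Germ P)} (h : H ⊆ K) :
    reducedAlgebra H ⊆ reducedAlgebra K :=
  closure_mono fun _ ⟨f, h1, h2, h3, h4⟩ => ⟨f, h1, h2, h3.trans h, h4⟩

open CategoryTheory in
-- Applying λ(f) to the delta function at a unit recovers f on the germs with that source, so values
-- of f can be read off the operator.
theorem IsRegularRep.apply_unit {f : Germ P → ℂ} {T : L2 P →L[ℂ] L2 P} (h : IsRegularRep f T)
    (g : Germ P) :
    open Classical in T (lp.single 2 (Germ.unit g.src) (1 : ℂ)) g = f g := by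
  have := h.1 g.src g.src g.tgt ⟨g, rfl, rfl⟩ (𝟙 g.src)
  refine this.trans (congrArg f ?_)
  have h1 : Groupoid.inv (𝟙 g.src) ≫ (⟨g, rfl, rfl⟩ : g.src ⟶ g.tgt) = ⟨g, rfl, rfl⟩ := by simp
  rw [h1]

/-- The coefficient at `g ∉ H` vanishes on `C*_r(H)`. -/
theorem apply_unit_eq_zero {H : Set (Germ P)} {T : L2 P →L[ℂ] L2 P} (hT : T ∈ reducedAlgebra H)
    {g : Germ P} (hg : g ∉ H) :
    open Classical in T (lp.single 2 (Germ.unit g.src) (1 : ℂ)) g = 0 := by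
  classical
  -- The coefficient is continuous in the operator norm, so its vanishing passes from the operators
  -- λ(f) to their closure.
  have hc : Continuous fun T : L2 P →L[ℂ] L2 P =>
      (T (lp.single 2 (Germ.unit g.src) (1 : ℂ)) : Germ P → ℂ) g :=
    (lp.evalCLM ℂ (fun _ : Germ P => ℂ) 2 g).continuous.comp
      (continuous_eval_const (F := L2 P →L[ℂ] L2 P)
        (lp.single 2 (Germ.unit g.src) (1 : ℂ) : L2 P))
  refine closure_minimal ?_ (isClosed_eq hc continuous_const) hT
  rintro S ⟨f, -, -, hf, hS⟩
  refine (hS.apply_unit g).trans ?_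
  by_contra hne
  exact hg (hf (subset_tsupport f hne))

/-- The indicator of the bisection of s gives an operator in the larger algebra. Its coefficient at
a germ of s outside H is 1, whereas all of C*_r(H) has coefficient 0 there. -/
theorem reducedAlgebra_ssubset {H K : Set (Germ P)} (h : H ⊆ K) {s : BoolHull P}
    (hs : ∀ χ h, Omega.act s χ h = χ) (hagree : ∀ t : BoolHull P, IsBool (Germ.agree s.1 t.1))
    (hsK : Germ.bisection s ⊆ K) (hsH : ¬ Germ.bisection s ⊆ H) :
    reducedAlgebra H ⊂ reducedAlgebra K := by
  refine ⟨reducedAlgebra_mono h, fun hKH => ?_⟩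
  obtain ⟨g, hgs, hgH⟩ := Set.not_subset.1 hsH
  obtain ⟨T, hT⟩ := exists_isRegularRep_bisection hs
  have hclosed := Germ.isClosed_bisection hagree
  have hsupp : tsupport ((Germ.bisection s).indicator fun _ => (1 : ℂ)) ⊆ Germ.bisection s :=
    closure_minimal Set.support_indicator_subset hclosed
  have hTK : T ∈ reducedAlgebra K := subset_closure
    ⟨_, IsClopen.continuous_indicator ⟨hclosed, Germ.isOpen_bisection s⟩ continuous_const,
      (Germ.isCompact_bisection s).of_isClosed_subset (isClosed_tsupport _) hsupp,
      hsupp.trans hsK, hT⟩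
  have h0 := (hT.apply_unit g).symm.trans (apply_unit_eq_zero (hKH hTK) hgH)
  rw [Set.indicator_of_mem hgs] at h0
  exact one_ne_zero h0

end Representation

/-! ### The left inverse hull of `ℕ^× ⋉ ℤ/nℤ` -/

namespace NatSemiZMod

variable {n : ℕ+}

@[simp] theorem fst_mul (p q : NatSemiZMod n) : (p * q).fst = p.fst * q.fst := rfl

@[simp] theorem snd_mul (p q : NatSemiZMod n) :
    (p * q).snd = p.snd * ((q.fst : ℕ) : ZMod n) + q.snd := rfl

@[simp] theorem fst_one : (1 : NatSemiZMod n).fst = 1 := rfl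

@[simp] theorem snd_one : (1 : NatSemiZMod n).snd = 0 := rfl

/-- Right multiplication by (1,[j]) adds [j] to the second coordinate, and sets in `E` are right
ideals. So `E` cannot see the second coordinate. -/
theorem mem_of_fst_eq (e : E (NatSemiZMod n)) {x y : NatSemiZMod n} (h : x.fst = y.fst)
    (hx : x ∈ e.1) : y ∈ e.1 := by
  convert e.mul_mem hx ⟨1, y.snd - x.snd⟩ using 1
  ext <;> simp [h]

/-- On its domain, such an s neither enters nor leaves any set of `E`, so the preimage of e under s
is e ∩ dom s, and χ already contains dom s. -/
theorem act_eq_self {s : BoolHull (NatSemiZMod n)} (hs : ∀ x y, y ∈ s.1 x → y.fst = x.fst)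
    (χ : Omega (NatSemiZMod n)) (h : χ.Mem (dom s.1)) : Omega.act s χ h = χ := by
  refine Omega.ext' fun e => ?_
  rw [Omega.mem_act _ e.isBool]
  constructor
  · refine fun hm => hm.mono ?_
    rintro x ⟨y, hy, hye⟩
    exact mem_of_fst_eq e (hs x y hy) hye
  · refine fun hm => (hm.inter h).mono ?_
    rintro x ⟨hx, y, hy⟩
    exact ⟨y, hy, mem_of_fst_eq e (hs x y hy).symm hx⟩

/-- Every element of the left inverse hull is of the form `(a b, l) ↦ (a' b, l + k b)`. -/
theorem exists_form {s : NatSemiZMod n ≃. NatSemiZMod n} (hs : InHull s) :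
    ∃ (a a' : ℕ+) (k : ZMod n), ∀ x y, y ∈ s x ↔
      ∃ b : ℕ+, x.fst = a * b ∧ y.fst = a' * b ∧ y.snd = x.snd + k * ((b : ℕ) : ZMod n) := by
  induction hs with
  | leftMul c =>
    refine ⟨1, c.fst, c.snd, fun x y => ?_⟩
    rw [mem_leftMul]
    constructor
    · rintro rfl
      exact ⟨x.fst, by simp, by simp, by simp [add_comm]⟩
    · rintro ⟨b, h1, h2, h3⟩
      rw [one_mul] at h1
      ext
      · simp [h1, h2]
      · simp [h1, h3, add_comm]
  | symm _ ih =>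
    obtain ⟨a, a', k, h⟩ := ih
    refine ⟨a', a, -k, fun x y => ?_⟩
    rw [PEquiv.mem_iff_mem, h]
    refine exists_congr fun b => ⟨?_, ?_⟩
    · rintro ⟨h1, h2, h3⟩
      exact ⟨h2, h1, by rw [h3]; ring⟩
    · rintro ⟨h1, h2, h3⟩
      exact ⟨h2, h1, by rw [h3]; ring⟩
  | trans _ _ iht ihs =>
    obtain ⟨a, a', k, ht⟩ := iht
    obtain ⟨c, c', j, hs⟩ := ihs
    obtain ⟨u, hu⟩ := PNat.dvd_lcm_left a' c
    obtain ⟨v, hv⟩ := PNat.dvd_lcm_right a' c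
    -- Composability of the two forms is the equation a'b = cd. Its solutions are the common
    -- multiples of a' and c, parametrised by e through the least common multiple a'u = cv.
    have huv : ∀ b d : ℕ+, a' * b = c * d → ∃ e, b = u * e ∧ d = v * e := by
      intro b d hbd
      obtain ⟨e, he⟩ := PNat.lcm_dvd (Dvd.intro b rfl) (Dvd.intro d hbd.symm)
      refine ⟨e, mul_left_cancel (a := a') ?_, mul_left_cancel (a := c) ?_⟩
      · rw [he, hu, mul_assoc]
      · rw [← hbd, he, hv, mul_assoc]
    refine ⟨a * u, c' * v, k * ((u : ℕ) : ZMod n) + j * ((v : ℕ) : ZMod n), fun x y => ?_⟩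
    rw [PEquiv.mem_trans]
    simp only [ht, hs]
    constructor
    · rintro ⟨z, ⟨b, h1, h2, h3⟩, d, h4, h5, h6⟩
      obtain ⟨e, rfl, rfl⟩ := huv b d (h2.symm.trans h4)
      refine ⟨e, by rw [h1, mul_assoc], by rw [h5, mul_assoc], ?_⟩
      rw [h6, h3]
      push_cast
      ring
    · rintro ⟨e, h1, h2, h3⟩
      refine ⟨⟨a' * (u * e), x.snd + k * (((u * e : ℕ+) : ℕ) : ZMod n)⟩,
        ⟨u * e, by rw [h1, mul_assoc], rfl, rfl⟩, v * e, ?_, by rw [h2, mul_assoc], ?_⟩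
      · simp only [← mul_assoc, ← hu, ← hv]
      · rw [h3]
        push_cast
        ring

/-- Since (a,[0])(b,[l]) = (ab,[l]), this set is the range of left multiplication by (a,[0]). -/
theorem inHull_idem_multiples (a : ℕ+) :
    InHull (idem {x : NatSemiZMod n | ∃ b, x.fst = a * b}) := by
  convert inHull_idem_pre (InHull.leftMul (⟨a, 0⟩ : NatSemiZMod n)).symm inHull_idem_univ using 2
  ext x
  simp only [pre, PEquiv.mem_iff_mem, mem_leftMul, Set.mem_univ, and_true, Set.mem_ofPred_eq]
  constructor
  · rintro ⟨b, hb⟩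
    exact ⟨⟨b, x.snd⟩, by ext <;> simp [hb]⟩
  · rintro ⟨y, rfl⟩
    exact ⟨y.fst, rfl⟩

/-- In the normal form, (ab,[l]) is fixed exactly when a = a' and kb = 0 in ℤ/nℤ, that is, when the
additive order o of k divides b. The fixed set is then that of the multiples of ao; if a ≠ a' it is
empty. -/
theorem isBool_fixed {s : NatSemiZMod n ≃. NatSemiZMod n} (hs : InHull s) :
    IsBool {x | x ∈ s x} := by
  obtain ⟨a, a', k, h⟩ := exists_form hs
  by_cases ha : a = a'
  · subst ha
    -- The order of k is positive because ℤ/nℤ is finite, n being positive.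
    obtain ⟨o, ho⟩ : ∃ o : ℕ+, (o : ℕ) = addOrderOf k := ⟨⟨_, addOrderOf_pos k⟩, rfl⟩
    convert E.isBool ⟨_, inHull_idem_multiples (n := n) (a * o)⟩ using 1
    ext x
    simp only [Set.mem_ofPred_eq, h]
    constructor
    · rintro ⟨b, h1, -, h3⟩
      have h4 : (b : ℕ) • k = 0 := by
        rw [nsmul_eq_mul, mul_comm]
        exact left_eq_add.1 h3
      obtain ⟨d, hd⟩ := addOrderOf_dvd_iff_nsmul_eq_zero.2 h4
      have hd0 : 0 < d := Nat.pos_of_ne_zero fun h0 => b.pos.ne' (by rw [hd, h0, mul_zero])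
      lift d to ℕ+ using hd0
      refine ⟨d, ?_⟩
      rw [h1, mul_assoc, PNat.eq (n := o * d) (hd.trans (by rw [PNat.mul_coe, ho]))]
    · rintro ⟨d, hd⟩
      refine ⟨o * d, by rw [hd, mul_assoc], by rw [hd, mul_assoc], ?_⟩
      have h4 : ((o * d : ℕ+) : ℕ) • k = 0 :=
        addOrderOf_dvd_iff_nsmul_eq_zero.1 (by rw [PNat.mul_coe, ho]; exact dvd_mul_right _ _)
      rw [nsmul_eq_mul, mul_comm] at h4
      exact left_eq_add.2 h4
  · convert isBool_empty (P := NatSemiZMod n)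
    rw [Set.eq_empty_iff_forall_notMem]
    intro x hx
    obtain ⟨b, h1, h2, -⟩ := (h x x).1 hx
    exact ha (mul_right_cancel (h1.symm.trans h2))

/-- An element of Ī_l is a restriction of some t in the hull to a set X in Ē. It agrees with s
exactly at the points of X fixed by s⁻¹t, which is again in the hull. -/
theorem isBool_agree {s : NatSemiZMod n ≃. NatSemiZMod n} (hs : InHull s)
    (t : BoolHull (NatSemiZMod n)) : IsBool (Germ.agree s t.1) := by
  obtain ⟨_, t, X, ht, hX, -, rfl⟩ := t
  convert hX.inter (isBool_fixed (ht.trans hs.symm)) using 1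
  ext x
  simp only [Germ.agree, mem_restrict, Set.mem_ofPred_eq, Set.mem_inter_iff, PEquiv.mem_trans,
    PEquiv.mem_iff_mem]
  constructor
  · rintro ⟨y, h1, h2, h3⟩
    exact ⟨h2, y, h3, h1⟩
  · rintro ⟨h2, y, h3, h1⟩
    exact ⟨y, h1, h2, h3⟩

/-! ### Unit germs and the exceptional germ -/

theorem unitGerms_subset :
    unitGerms (NatSemiZMod n) ⊆ interior (isotropy (NatSemiZMod n)) := by
  rintro _ ⟨u, χ, rfl⟩
  refine Germ.bisection_subset_interior_isotropy (act_eq_self fun x y h => ?_)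
    (Germ.mk_mem_bisection _ _ _)
  -- The first coordinate of a unit is invertible in ℕ^×, hence 1, so multiplication by the unit
  -- preserves first coordinates.
  have hu : (u : NatSemiZMod n).fst = 1 := by
    have := congrArg fst u.mul_inv
    simp only [fst_mul, fst_one] at this
    exact (mul_eq_one_iff_of_one_le one_le one_le).1 this |>.1
  rw [mem_leftMul.1 h, fst_mul, hu, one_mul]

theorem conjGerm_notMem_unitGerms (hn : 1 < n) :
    conjGerm (⟨n, 0⟩ : NatSemiZMod n) ⟨1, 1⟩ ∉ unitGerms (NatSemiZMod n) := by
  rintro ⟨u, χ, h⟩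
  obtain ⟨-, X, hX, hm, he⟩ := Germ.mk_eq_iff.1 h
  -- The set on which the two maps agree contains (n,[0]) itself.
  have hc := (Omega.principal_mem_iff _ hX).1 hm
  have h1 := (he _ hc _).1 (mem_conj.2 ⟨1, (mul_one _).symm, rfl⟩)
  have h2 := congrArg snd (mem_leftMul.1 h1)
  have : Fact (1 < (n : ℕ)) := ⟨hn⟩
  -- The second coordinates of the two images of (n,[0]) give 1 = kn + 0 = 0 in ℤ/nℤ, where [k] is
  -- the second coordinate of u; this is impossible for n > 1.
  simp at h2

end NatSemiZMod

end Hull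

theorem mainTheorem6 (n : ℕ+) (hn : 1 < n) :
    Hull.unitGerms (Hull.NatSemiZMod n) ⊂ interior (Hull.isotropy (Hull.NatSemiZMod n)) ∧
    Hull.conjGerm (⟨n, 0⟩ : Hull.NatSemiZMod n) ⟨1, 1⟩ ∈
      interior (Hull.isotropy (Hull.NatSemiZMod n)) ∧
    Hull.conjGerm (⟨n, 0⟩ : Hull.NatSemiZMod n) ⟨1, 1⟩ ∉
      Hull.unitGerms (Hull.NatSemiZMod n) ∧
    Hull.reducedAlgebra (Hull.unitGerms (Hull.NatSemiZMod n)) ⊂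
      Hull.reducedAlgebra (interior (Hull.isotropy (Hull.NatSemiZMod n))) := by
  have hs := Hull.NatSemiZMod.act_eq_self (n := n)
    (s := .ofHull (Hull.inHull_conj (⟨n, 0⟩ : Hull.NatSemiZMod n) ⟨1, 1⟩)) (by
      rintro x y h
      obtain ⟨z, rfl, rfl⟩ := Hull.mem_conj.1 h
      simp)
  have hsub := Hull.Germ.bisection_subset_interior_isotropy hs
  have hmem := Hull.Germ.mk_mem_bisection (.ofHull (Hull.inHull_conj _ _)) _
    (Hull.mem_dom_conj (⟨n, 0⟩ : Hull.NatSemiZMod n) ⟨1, 1⟩)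
  have hnot := Hull.NatSemiZMod.conjGerm_notMem_unitGerms hn
  have hunit := Hull.NatSemiZMod.unitGerms_subset (n := n)
  exact ⟨⟨hunit, fun h => hnot (h (hsub hmem))⟩, hsub hmem, hnot,
    Hull.reducedAlgebra_ssubset hunit hs
      (Hull.NatSemiZMod.isBool_agree (Hull.inHull_conj _ _)) hsub fun h => hnot (h hmem)⟩
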